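/- Let $E$ be a real ordered Banach space whose (closed) positive cone $K=\{x\in E: x\ge\theta\}$ is normal. Let $A:D(A)\subset E\to E$ be a closed linear operator such that $-A$ generates a $C_0$-semigroup $T(t)$ $(t\ge 0)$ which is positive ($T(t)K\subset K$ for all $t\ge0$) and equicontinuous ($t\mapsto T(t)$ is continuous in operator norm for $t>0$). Let $\omega>0$, $\tau\ge 0$, and let $F:\mathbb R\times E\times E\to E$ be continuous and $\omega$-periodic in its first variable. Write $C_\omega(\mathbb R,E)$ for the space of continuous $\omega$-periodic functions $\mathbb R\to E$ with the maximum norm and the pointwise order, and $E_1=D(A)$ with the graph norm. Suppose that $$u'(t)+Au(t)=F(t,u(t),u(t-\tau)),\qquad t\in\mathbb R,\tag{1}$$ has $\omega$-periodic lower and upper solutions $v_0\le w_0$, that is, $v_0,w_0\in C^1_\omega(\mathbb R,E)\cap C_\omega(\mathbb R,E_1)$ satisfy $v_0'(t)+Av_0(t)\le F(t,v_0(t),v_0(t-\tau))$ and $w_0'(t)+Aw_0(t)\ge F(t,w_0(t),w_0(t-\tau))$ for all $t\in\mathbb R$. Let $[v_0,w_0]=\{u\in C_\omega(\mathbb R,E):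 v_0\le u\le w_0\}$, and let $\alpha$ denote the Kuratowski measure of noncompactness in $E$. Assume that there is a constant $C\ge0$ such that, with $S(t)=e^{-Ct}T(t)$, the operator $I-S(\omega)$ has a bounded inverse and $\sup_{t\ge0}\|S(t)\|<\infty$ (so that $C_S=\|(I-S(\omega))^{-1}\|$ and $M_S=\sup_{t\ge0}\|S(t)\|$ are well defined), and such that the following hold. (H1) For all $t\in\mathbb R$, $v_0(t)\le x_1\le x_2\le w_0(t)$ and $v_0(t-\tau)\le y_1\le y_2\le w_0(t-\tau)$, $$F(t,x_2,y_2)-F(t,x_1,y_1)\ge -C(x_2-x_1).$$ (H2) There is a constant $c\ge 0$ with $4\omega C_SM_S\,c<1$ such that for all $t\in\mathbb R$ and all monotone (increasing or decreasing) sequences $\{u_n\}\subset[v_0,w_0]$, $$\alpha(\{F(t,u_n(t),u_n(t-\tau))+Cu_n(t)\})\le c\,\big(\alpha(\{u_n(t)\})+\alpha(\{u_n(t-\tau)\})\big).$$ Then (1) has a minimal and a maximal $\omega$-periodic mild solution $\underline u,\overline u$ in $[v_0,w_0]$: both are $\omega$-periodic mild solutions in $[v_0,w_0]$, and every $\omega$-periodic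 mild solution $u\in[v_0,w_0]$ satisfies $\underline u\le u\le\overline u$. Here an $\omega$-periodic mild solution is a function $u\in C_\omega(\mathbb R,E)$ with $u(t)=T(t-a)u(a)+\int_a^tT(t-s)F(s,u(s),u(s-\tau))\,ds$ for all $a\le t$. Moreover, $\underline u$ and $\overline u$ are obtained by monotone iteration: with $$(Qu)(t)=(I-S(\omega))^{-1}\int_{t-\omega}^{t}S(t-s)\big(F(s,u(s),u(s-\tau))+Cu(s)\big)\,ds,$$ the sequences $v_i=Qv_{i-1}$ and $w_i=Qw_{i-1}$ $(i\ge1)$ lie in $[v_0,w_0]$, $\{v_i\}$ is increasing, $\{w_i\}$ is decreasing, and $v_i\to\underline u$, $w_i\to\overline u$ in $C_\omega(\mathbb R,E)$. -/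

import Mathlib

open Set Filter Topology
open scoped ENNReal

namespace DelayEvolution

section Semigroup

variable {E : Type*} [NormedAddCommGroup E] [NormedSpace ℝ E]

/-- `T(t)`, `t ≥ 0`, is a strongly continuous semigroup (`C₀`-semigroup) of bounded linear operators
on `E`. Only the values of `T` at times `t ≥ 0` are meaningful. -/
structure IsC0Semigroup (T : ℝ → E →L[ℝ] E) : Prop where
  map_zero : T 0 = 1
  map_add : ∀ s t : ℝ, 0 ≤ s → 0 ≤ t → T (s + t) = T s * T t
  strong_continuous : ∀ x : E, ContinuousOn (fun t => T t x) (Ici 0)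

/-- The (unbounded) operator `B` is the infinitesimal generator of `T`: its domain consists of the
`x` for which `lim_{t → 0+} (T(t)x - x)/t` exists, and `B x` is this limit. -/
def IsGenerator (T : ℝ → E →L[ℝ] E) (B : E →ₗ.[ℝ] E) : Prop :=
  ∀ x y : E, (x, y) ∈ B.graph ↔ Tendsto (fun t : ℝ => t⁻¹ • (T t x - x)) (𝓝[>] 0) (𝓝 y)

/-- An equicontinuous semigroup: `t ↦ T(t)` is continuous in the operator norm for `t > 0`. -/
def IsEquicontinuousSemigroup (T : ℝ → E →L[ℝ] E) : Prop :=
  ContinuousOn T (Ioi 0)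

/-- A positive semigroup: `T(t) x ≥ 0` for all `x ≥ 0` and `t ≥ 0`. -/
def IsPositiveSemigroup [PartialOrder E] (T : ℝ → E →L[ℝ] E) : Prop :=
  ∀ t : ℝ, 0 ≤ t → ∀ x : E, 0 ≤ x → 0 ≤ T t x

/-- The semigroup `S(t) = e^{-Ct} T(t)`, generated by `-(A + C I)` if `-A` generates `T`. -/
noncomputable def expShift (C : ℝ) (T : ℝ → E →L[ℝ] E) : ℝ → E →L[ℝ] E :=
  fun t => Real.exp (-C * t) • T t

/-- `C_S = ‖(I - S(ω))⁻¹‖`; meaningful if `I - S(ω)` is invertible. -/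
noncomputable def resolventConst (S : ℝ → E →L[ℝ] E) (ω : ℝ) : ℝ :=
  ‖Ring.inverse (1 - S ω)‖

/-- `M_S = sup {‖S(t)‖ : t ≥ 0}`; meaningful if this set is bounded above. -/
noncomputable def semigroupSup (S : ℝ → E →L[ℝ] E) : ℝ :=
  sSup ((fun t => ‖S t‖) '' Ici 0)

end Semigroup

section Order

variable {E : Type*} [NormedAddCommGroup E] [PartialOrder E]

variable (E) in
/-- The positive cone `{x | 0 ≤ x}` of `E` is normal. -/
def HasNormalCone : Prop :=
  ∃ N : ℝ, ∀ x y : E, 0 ≤ x → x ≤ y → ‖x‖ ≤ N * ‖y‖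

/-- The order interval `[v, w]` in the space `C_ω(ℝ, E)` of continuous `ω`-periodic functions. -/
def periodicIcc (ω : ℝ) (v w : ℝ → E) : Set (ℝ → E) :=
  {u | Continuous u ∧ Function.Periodic u ω ∧ v ≤ u ∧ u ≤ w}

end Order

/-- The Kuratowski measure of noncompactness of `B`: the infimum of the `d` such that `B` can be
covered by finitely many sets of diameter at most `d`. -/
noncomputable def kuratowski {E : Type*} [PseudoEMetricSpace E] (B : Set E) : ℝ≥0∞ :=
  sInf {d : ℝ≥0∞ | ∃ P : Set (Set E), P.Finite ∧ B ⊆ ⋃₀ P ∧ ∀ U ∈ P, Metric.ediam U ≤ d}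

section Equation

variable {E : Type*} [NormedAddCommGroup E] [NormedSpace ℝ E]

/-- `v ∈ C¹_ω(ℝ, E) ∩ C_ω(ℝ, E₁)`, where `E₁` is the domain `D(A)` with the graph norm. -/
structure IsRegularPeriodic (A : E →ₗ.[ℝ] E) (ω : ℝ) (v : ℝ → E) : Prop where
  contDiff : ContDiff ℝ 1 v
  periodic : Function.Periodic v ω
  mem_domain : ∀ t, v t ∈ A.domain
  continuous_apply : Continuous fun t => A ⟨v t, mem_domain t⟩

/-- An `ω`-periodic lower solution of `u'(t) + A u(t) = F(t, u(t), u(t - τ))`. -/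
structure IsLowerSolution [PartialOrder E] (A : E →ₗ.[ℝ] E) (F : ℝ → E → E → E) (ω τ : ℝ)
    (v : ℝ → E) : Prop extends IsRegularPeriodic A ω v where
  le : ∀ t, deriv v t + A ⟨v t, mem_domain t⟩ ≤ F t (v t) (v (t - τ))

/-- An `ω`-periodic upper solution of `u'(t) + A u(t) = F(t, u(t), u(t - τ))`. -/
structure IsUpperSolution [PartialOrder E] (A : E →ₗ.[ℝ] E) (F : ℝ → E → E → E) (ω τ : ℝ)
    (w : ℝ → E) : Prop extends IsRegularPeriodic A ω w where
  ge : ∀ t, F t (w t) (w (t - τ)) ≤ deriv w t + A ⟨w t, mem_domain t⟩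

/-- An `ω`-periodic mild solution on `ℝ` of `u'(t) + A u(t) = F(t, u(t), u(t - τ))`, where `-A`
generates the semigroup `T`. -/
structure IsPeriodicMildSolution (T : ℝ → E →L[ℝ] E) (F : ℝ → E → E → E) (ω τ : ℝ)
    (u : ℝ → E) : Prop where
  continuous : Continuous u
  periodic : Function.Periodic u ω
  eq : ∀ a t : ℝ, a ≤ t →
    u t = T (t - a) (u a) + ∫ s in a..t, T (t - s) (F s (u s) (u (s - τ)))

/-- The operator of the monotone iteration,
`(Q u)(t) = (I - S(ω))⁻¹ ∫_{t-ω}^t S(t-s) (F(s, u(s), u(s-τ)) + C u(s)) ds`,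
with `S(t) = e^{-Ct} T(t)`. -/
noncomputable def iterOp (T : ℝ → E →L[ℝ] E) (F : ℝ → E → E → E) (ω τ C : ℝ) (u : ℝ → E) :
    ℝ → E :=
  fun t => Ring.inverse (1 - expShift C T ω)
    (∫ s in (t - ω)..t, expShift C T (t - s) (F s (u s) (u (s - τ)) + C • u s))

end Equation

end DelayEvolution

open DelayEvolution

/-! Adding `C u` to both sides replaces `T` by `S` and, by (H1), makes the right-hand side
increasing on `[v₀, w₀]`. Since `1 - S ω` is invertible, the periodic mild solutions are exactly the
fixed points of `Q` (`isPeriodicMildSolution_iff`). The operator `Q` is increasing because `S` and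
`(1 - S ω)⁻¹` are positive (`inverse_one_sub_apply_nonneg`). A lower solution is itself given by the
resolvent formula, with a forcing below its shifted nonlinearity, so `v₀ ≤ Q v₀`; dually `Q w₀ ≤
w₀`. The iterates are therefore monotone and stay in the interval.

Convergence comes from compactness (`exists_tendstoUniformly_iterOp`). Let `κ` be the supremum over
`t` of the measure of noncompactness of the iterates at `t`. By `kuratowski_range_integral_le`,
integrating a sequence over a period costs a factor `2ω`, and (H2) contributes `c(κ + κ)`; hence `κ
≤ 4ω C_S M_S c κ`, which forces `κ = 0`. In a normal cone a monotone sequence with relatively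
compact range is Cauchy, so the iterates converge pointwise. Dominated convergence over one period
makes the convergence uniform, and the limit is a fixed point. Comparing any other fixed point with
the iterates gives extremality. -/

namespace DelayEvolution

open MeasureTheory
open scoped NNReal

/-! ### Elementary properties of the measure of noncompactness. -/

section Kuratowski

variable {X Y : Type*} [PseudoEMetricSpace X] [PseudoEMetricSpace Y]

theorem kuratowski_mono {B B' : Set X} (h : B ⊆ B') : kuratowski B ≤ kuratowski B' :=
  sInf_le_sInf fun _ ⟨P, hP, hB, hd⟩ => ⟨P, hP, h.trans hB, hd⟩

theorem kuratowski_le_ediam (B : Set X) : kuratowski B ≤ Metric.ediam B :=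
  sInf_le ⟨{B}, finite_singleton B, by simp, by simp⟩

theorem kuratowski_insert_le (x : X) (B : Set X) : kuratowski (insert x B) ≤ kuratowski B := by
  refine le_sInf fun d ⟨P, hP, hB, hd⟩ => sInf_le ⟨insert {x} P, hP.insert _, ?_, ?_⟩
  · rw [sUnion_insert]
    exact insert_subset (Or.inl rfl) (hB.trans subset_union_right)
  · rintro U (rfl | hU)
    · simp
    · exact hd U hU

theorem kuratowski_image_le {K : ℝ≥0} {f : X → Y} (hf : LipschitzWith K f) (B : Set X) :
    kuratowski (f '' B) ≤ K * kuratowski B := by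
  have key : ∀ d : ℝ≥0∞, (∃ P : Set (Set X), P.Finite ∧ B ⊆ ⋃₀ P ∧
      ∀ U ∈ P, Metric.ediam U ≤ d) → kuratowski (f '' B) ≤ K * d := by
    rintro d ⟨P, hP, hB, hd⟩
    refine sInf_le ⟨(fun U => f '' U) '' P, hP.image _, ?_, ?_⟩
    · rintro _ ⟨x, hx, rfl⟩
      obtain ⟨U, hU, hxU⟩ := hB hx
      exact ⟨f '' U, ⟨U, hU, rfl⟩, x, hxU, rfl⟩
    · rintro _ ⟨U, hU, rfl⟩
      exact (hf.ediam_image_le U).trans (mul_le_mul_right (hd U hU) _)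
  rcases eq_or_ne K 0 with rfl | hK
  · refine (kuratowski_le_ediam _).trans ((hf.ediam_image_le B).trans ?_)
    simp
  · rw [kuratowski.eq_1 B, sInf_eq_iInf', ENNReal.mul_iInf_of_ne (by simpa) (by simp)]
    exact le_iInf fun d => key d d.2

theorem kuratowski_range_comp_le {ι : Type*} {K : ℝ≥0} {f : X → Y} (hf : LipschitzWith K f)
    (x : ι → X) : kuratowski (range fun i => f (x i)) ≤ K * kuratowski (range x) := by
  have := kuratowski_image_le hf (range x)
  rwa [← range_comp] at this

end Kuratowski

/-! ### Measure of noncompactness and distance to finite-dimensional subspaces. -/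

section FiniteDimensional

variable {E : Type*} [NormedAddCommGroup E] [NormedSpace ℝ E]

/-- The quotient norm is the distance to `V`. Boundedness keeps the approximants in a compact ball
of `V`; a finite net there yields finitely many balls of radius slightly above `r` covering `B`. The
factor 2 is the passage from radius to diameter. -/
theorem kuratowski_le_of_enorm_mkQ_le {B : Set E} (hB : Bornology.IsBounded B)
    (V : Submodule ℝ E) [FiniteDimensional ℝ V] {r : ℝ≥0∞}
    (hr : ∀ x ∈ B, ‖(Submodule.Quotient.mk x : E ⧸ V)‖ₑ ≤ r) : kuratowski B ≤ 2 * r := by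
  rcases eq_or_ne r ⊤ with rfl | hr_top
  · simp
  obtain ⟨M, hM⟩ := hB.exists_norm_le
  lift r to ℝ≥0 using hr_top
  have key : ∀ ε : ℝ≥0, 0 < ε → kuratowski B ≤ 2 * (r : ℝ≥0∞) + ε := by
    intro ε' hε'
    -- One `ε` is lost in approximating the distance to `V` and one in the net; balls of radius `r +
    -- 2ε` have diameter at most `2r + 4ε`.
    obtain ⟨ε, hε, rfl⟩ : ∃ ε : ℝ≥0, 0 < ε ∧ ε' = 4 * ε :=
      ⟨ε' / 4, by positivity, by field_simp⟩
    have hnear : ∀ x ∈ B, ∃ v : V, ‖x - v‖ < r + ε := by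
      intro x hx
      obtain ⟨m, hm, hm'⟩ := Submodule.Quotient.norm_mk_lt
        (Submodule.Quotient.mk x : E ⧸ V) (ε := ε) (by exact_mod_cast hε)
      have hrx := hr x hx
      rw [enorm_le_coe] at hrx
      have hrx : ‖(Submodule.Quotient.mk x : E ⧸ V)‖ ≤ r := hrx
      rw [Submodule.Quotient.eq] at hm
      refine ⟨⟨x - m, by rw [← neg_sub]; exact V.neg_mem hm⟩, ?_⟩
      simp only [sub_sub_cancel]
      linarith
    have : ProperSpace V := FiniteDimensional.proper ℝ V
    obtain ⟨t, -, ht, hcov⟩ := (isCompact_closedBall (0 : V) (M + r + ε)).finite_cover_balls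
      (e := (ε : ℝ)) (by exact_mod_cast hε)
    refine sInf_le ⟨(fun p : V => Metric.closedBall (p : E) ((r + 2 * ε : ℝ≥0) : ℝ)) '' t,
      ht.image _, ?_, ?_⟩
    · intro x hx
      obtain ⟨v, hv⟩ := hnear x hx
      have hvM : v ∈ Metric.closedBall (0 : V) (M + r + ε) := by
        rw [mem_closedBall_zero_iff]
        have := norm_sub_norm_le (v : E) x
        rw [norm_sub_rev] at this
        have := hM x hx
        rw [Submodule.coe_norm]
        linarith
      obtain ⟨p, hp, hvp⟩ := mem_iUnion₂.1 (hcov hvM)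
      refine ⟨_, ⟨p, hp, rfl⟩, ?_⟩
      rw [Metric.mem_ball, dist_eq_norm, Submodule.coe_norm, Submodule.coe_sub] at hvp
      rw [Metric.mem_closedBall, dist_eq_norm]
      have := norm_add_le (x - v) ((v : E) - p)
      rw [sub_add_sub_cancel] at this
      push_cast
      linarith
    · rintro _ ⟨p, -, rfl⟩
      simp only
      rw [← Metric.closedEBall_coe]
      refine Metric.ediam_closedEBall_le.trans ?_
      push_cast
      rw [mul_add, ← mul_assoc]
      norm_num
  refine ENNReal.le_of_forall_pos_le_add fun ε hε _ => key ε hε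

/-- If `d` is dense in the range of `x`, then `x` lies up to the measure of noncompactness of its
range in a uniform neighbourhood of the span of finitely many of the `d i`. -/
theorem iInf_iSup_enorm_mkQ_le {x d : ℕ → E} (hd : range x ⊆ closure (range d)) :
    ⨅ k, ⨆ n, ‖(Submodule.Quotient.mk (x n) : E ⧸ Submodule.span ℝ (d '' Iio k))‖ₑ ≤
      kuratowski (range x) := by
  refine le_sInf fun r ⟨P, hP, hcov, hdiam⟩ => ?_
  refine ENNReal.le_of_forall_pos_le_add fun ε hε _ => ?_
  -- One `d i` close to a single point of a piece is within `r + ε` of every `x n` in that piece, so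
  -- finitely many `d i` serve the whole cover.
  have hidx : ∀ U ∈ P, ∃ k : ℕ, ∀ n, x n ∈ U → ∃ i < k, edist (x n) (d i) ≤ r + ε := by
    intro U hU
    by_cases hne : ∃ m, x m ∈ U
    · obtain ⟨m, hm⟩ := hne
      obtain ⟨_, ⟨i, rfl⟩, hi⟩ :=
        EMetric.mem_closure_iff.1 (hd ⟨m, rfl⟩) ε (by exact_mod_cast hε)
      refine ⟨i + 1, fun n hn => ⟨i, i.lt_succ_self, ?_⟩⟩
      exact (edist_triangle _ (x m) _).trans
        (add_le_add ((Metric.edist_le_ediam_of_mem hn hm).trans (hdiam U hU)) hi.le)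
    · exact ⟨0, fun n hn => absurd ⟨n, hn⟩ hne⟩
  choose! k hk using hidx
  obtain ⟨K, hK⟩ := (hP.image k).bddAbove
  refine iInf_le_of_le K (iSup_le fun n => ?_)
  obtain ⟨U, hU, hnU⟩ := hcov ⟨n, rfl⟩
  obtain ⟨i, hi, hle⟩ := hk U hU n hnU
  refine le_trans ?_ hle
  have hmem : d i ∈ Submodule.span ℝ (d '' Iio K) :=
    Submodule.subset_span ⟨i, hi.trans_le (hK ⟨U, hU, rfl⟩), rfl⟩
  have : (Submodule.Quotient.mk (x n) : E ⧸ Submodule.span ℝ (d '' Iio K)) =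
      Submodule.Quotient.mk (x n - d i) := by
    rw [Submodule.Quotient.eq]
    simpa using hmem
  rw [this, edist_eq_enorm_sub, enorm_le_iff_norm_le]
  exact Submodule.Quotient.norm_mk_le _ _

end FiniteDimensional

/-! ### Measure of noncompactness of a sequence of integrals. -/

section Integral

variable {E : Type*} [NormedAddCommGroup E] [NormedSpace ℝ E] [CompleteSpace E]

/-- The distance of an integral to `V k` is at most the integral of the distances, hence of their
supremum `φ k`. As `k` grows, `φ k` decreases to a limit bounded by the pointwise measure of
noncompactness, and monotone convergence moves the infimum inside the integral. Measurability is
needed only for `φ k`, a countable supremum of continuous functions. -/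
theorem kuratowski_range_integral_le {h : ℕ → ℝ → E} (hcont : ∀ n, Continuous (h n)) {a b M : ℝ}
    (hab : a ≤ b) (hM : ∀ n, ∀ s ∈ Icc a b, ‖h n s‖ ≤ M) {κ : ℝ≥0∞}
    (hκ : ∀ s ∈ Icc a b, kuratowski (range fun n => h n s) ≤ κ) :
    kuratowski (range fun n => ∫ s in a..b, h n s) ≤ 2 * (ENNReal.ofReal (b - a) * κ) := by
  -- A single countable set approximates all values `h n s`, so the subspaces `V k` do not depend on
  -- `s`.
  obtain ⟨D, hDc, hD⟩ := TopologicalSpace.IsSeparable.iUnion fun n =>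
    TopologicalSpace.isSeparable_range (hcont n)
  have hDne : D.Nonempty := by
    rw [← closure_nonempty_iff]
    exact ⟨h 0 0, hD (mem_iUnion.2 ⟨0, 0, rfl⟩)⟩
  obtain ⟨d, rfl⟩ := hDc.exists_eq_range hDne
  set V : ℕ → Submodule ℝ E := fun k => Submodule.span ℝ (d '' Iio k) with hV
  have hVfin : ∀ k, FiniteDimensional ℝ (V k) := fun k =>
    FiniteDimensional.span_of_finite ℝ ((finite_Iio k).image d)
  have hVcl : ∀ k, IsClosed (V k : Set E) := fun k => (V k).closed_of_finiteDimensional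
  set φ : ℕ → ℝ → ℝ≥0∞ := fun k s => ⨆ n, ‖(Submodule.Quotient.mk (h n s) : E ⧸ V k)‖ₑ with hφ
  have hφ_meas : ∀ k, Measurable (φ k) := fun k => Measurable.iSup fun n =>
    (((V k).mkQL.continuous.comp (hcont n)).enorm).measurable
  have hφ_anti : Antitone φ := by
    intro k l hkl s
    refine iSup_mono fun n => ?_
    have hle : V k ≤ V l := Submodule.span_mono (image_mono (Iio_subset_Iio hkl))
    rw [enorm_le_iff_norm_le]
    change ‖((h n s : E) : E ⧸ (V l).toAddSubgroup)‖ ≤ ‖((h n s : E) : E ⧸ (V k).toAddSubgroup)‖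
    rw [QuotientAddGroup.norm_mk, QuotientAddGroup.norm_mk]
    exact Metric.infDist_le_infDist_of_subset hle ⟨0, (V k).zero_mem⟩
  have hint : ∀ k, kuratowski (range fun n => ∫ s in a..b, h n s) ≤
      2 * ∫⁻ s in Ioc a b, φ k s := by
    intro k
    have := hVfin k
    have := hVcl k
    refine kuratowski_le_of_enorm_mkQ_le ?_ (V k) ?_
    · refine isBounded_iff_forall_norm_le.2 ⟨M * |b - a|, ?_⟩
      rintro _ ⟨n, rfl⟩
      refine intervalIntegral.norm_integral_le_of_norm_le_const fun s hs => ?_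
      rw [uIoc_of_le hab] at hs
      exact hM n s (Ioc_subset_Icc_self hs)
    · rintro _ ⟨n, rfl⟩
      have hcomm := (V k).mkQL.intervalIntegral_comp_comm
        ((hcont n).intervalIntegrable (μ := volume) a b)
      change ‖(V k).mkQL (∫ s in a..b, h n s)‖ₑ ≤ _
      rw [← hcomm, intervalIntegral.integral_of_le hab]
      refine (enorm_integral_le_lintegral_enorm _).trans (lintegral_mono fun s => ?_)
      exact le_iSup (fun n => ‖(Submodule.Quotient.mk (h n s) : E ⧸ V k)‖ₑ) n
  -- Monotone convergence for a decreasing sequence needs one finite integral.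
  have hφ0 : ∫⁻ s in Ioc a b, φ 0 s ≠ ⊤ := by
    refine ne_top_of_le_ne_top (b := ∫⁻ s in Ioc a b, ENNReal.ofReal M) ?_ ?_
    · simp [ENNReal.mul_eq_top]
    · refine setLIntegral_mono' measurableSet_Ioc fun s hs => iSup_le fun n => ?_
      rw [← ofReal_norm]
      exact ENNReal.ofReal_le_ofReal ((Submodule.Quotient.norm_mk_le _ _).trans
        (hM n s (Ioc_subset_Icc_self hs)))
  calc kuratowski (range fun n => ∫ s in a..b, h n s)
      ≤ ⨅ k, 2 * ∫⁻ s in Ioc a b, φ k s := le_iInf hint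
    _ = 2 * ∫⁻ s in Ioc a b, ⨅ k, φ k s := by
      rw [lintegral_iInf hφ_meas hφ_anti hφ0, ENNReal.mul_iInf_of_ne (by simp) (by simp)]
    _ ≤ 2 * ∫⁻ s in Ioc a b, κ := by
      refine mul_le_mul_right (setLIntegral_mono' measurableSet_Ioc fun s hs => ?_) _
      refine le_trans (iInf_iSup_enorm_mkQ_le (x := fun n => h n s) ?_)
        (hκ s (Ioc_subset_Icc_self hs))
      rintro _ ⟨n, rfl⟩
      exact hD (mem_iUnion.2 ⟨n, s, rfl⟩)
    _ = 2 * (ENNReal.ofReal (b - a) * κ) := by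
      rw [setLIntegral_const, Real.volume_Ioc, mul_comm κ]

end Integral

/-! ### Monotone sequences in a space with normal cone. -/

section Order

variable {E : Type*} [NormedAddCommGroup E] [PartialOrder E]

theorem HasNormalCone.exists_pos (h : HasNormalCone E) :
    ∃ N : ℝ, 0 < N ∧ ∀ x y : E, 0 ≤ x → x ≤ y → ‖x‖ ≤ N * ‖y‖ := by
  obtain ⟨N, hN⟩ := h
  refine ⟨|N| + 1, by positivity, fun x y hx hxy => (hN x y hx hxy).trans ?_⟩
  gcongr
  linarith [le_abs_self N]

variable [IsOrderedAddMonoid E]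

theorem norm_sub_le_of_mem_Icc {N : ℝ} (hN : ∀ x y : E, 0 ≤ x → x ≤ y → ‖x‖ ≤ N * ‖y‖)
    {x y z : E} (hxy : x ≤ y) (hyz : y ≤ z) : ‖y - x‖ ≤ N * ‖z - x‖ :=
  hN _ _ (sub_nonneg.2 hxy) (sub_le_sub_right hyz x)

/-- In a finite cover by small sets, some piece is visited infinitely often. Every later term lies
in order between two visits to that piece, and normality turns this into closeness in norm. -/
theorem cauchySeq_of_monotone_of_kuratowski_eq_zero (hK : HasNormalCone E) {x : ℕ → E}
    (hx : Monotone x) (h0 : kuratowski (range x) = 0) : CauchySeq x := by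
  obtain ⟨N, hN0, hN⟩ := hK.exists_pos
  refine Metric.cauchySeq_iff'.2 fun ε hε => ?_
  have hlt : kuratowski (range x) < ENNReal.ofReal (ε / (2 * N)) := by
    rw [h0, ENNReal.ofReal_pos]
    positivity
  obtain ⟨d, ⟨P, hP, hcov, hdiam⟩, hd⟩ := sInf_lt_iff.1 hlt
  have hex : ∃ U ∈ P, ∃ᶠ n in atTop, x n ∈ U := by
    by_contra! hcon
    have : ∀ᶠ n in atTop, ∀ U ∈ P, x n ∉ U :=
      (eventually_all_finite hP).2 fun U hU => hcon U hU
    obtain ⟨n, hn⟩ := this.exists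
    obtain ⟨U, hU, hnU⟩ := hcov ⟨n, rfl⟩
    exact hn U hU hnU
  obtain ⟨U, hU, hfreq⟩ := hex
  obtain ⟨n₀, hn₀⟩ := hfreq.exists
  refine ⟨n₀, fun n hn => ?_⟩
  obtain ⟨m, hm, hmU⟩ := frequently_atTop.1 hfreq n
  have hle := norm_sub_le_of_mem_Icc hN (hx hn) (hx hm)
  have hdist : edist (x m) (x n₀) < ENNReal.ofReal (ε / (2 * N)) :=
    ((Metric.edist_le_ediam_of_mem hmU hn₀).trans (hdiam U hU)).trans_lt hd
  rw [edist_dist, ENNReal.ofReal_lt_ofReal_iff (by positivity), dist_eq_norm] at hdist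
  rw [dist_eq_norm]
  calc ‖x n - x n₀‖ ≤ N * ‖x m - x n₀‖ := hle
    _ ≤ N * (ε / (2 * N)) := by gcongr
    _ = ε / 2 := by field_simp
    _ < ε := by linarith

theorem cauchySeq_of_antitone_of_kuratowski_eq_zero (hK : HasNormalCone E) {x : ℕ → E}
    (hx : Antitone x) (h0 : kuratowski (range x) = 0) : CauchySeq x := by
  have hneg : CauchySeq fun n => -x n := by
    refine cauchySeq_of_monotone_of_kuratowski_eq_zero hK (fun m n h => neg_le_neg (hx h)) ?_
    have := kuratowski_range_comp_le (LipschitzWith.id.neg : LipschitzWith 1 fun y : E => -y) x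
    rw [h0, mul_zero] at this
    exact le_antisymm this zero_le
  simpa [Function.comp_def] using (uniformContinuous_neg (α := E)).comp_cauchySeq hneg

end Order

/-! ### Mild solutions, the exponential shift and the periodic resolvent formula. -/

section Semigroup

variable {E : Type*} [NormedAddCommGroup E] [NormedSpace ℝ E] {T S : ℝ → E →L[ℝ] E}

theorem expShift_apply (C : ℝ) (T : ℝ → E →L[ℝ] E) (t : ℝ) (x : E) :
    expShift C T t x = Real.exp (-C * t) • T t x := rfl

theorem expShift_neg_expShift (C : ℝ) (T : ℝ → E →L[ℝ] E) :
    expShift (-C) (expShift C T) = T := by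
  funext t
  simp only [expShift, smul_smul, ← Real.exp_add]
  simp

namespace IsC0Semigroup

theorem expShift (hT : IsC0Semigroup T) (C : ℝ) : IsC0Semigroup (expShift C T) where
  map_zero := by simp [DelayEvolution.expShift, hT.map_zero]
  map_add s t hs ht := by
    simp only [DelayEvolution.expShift, hT.map_add s t hs ht, mul_add, Real.exp_add,
      smul_mul_smul_comm]
  strong_continuous x := by
    have : Continuous fun t : ℝ => Real.exp (-C * t) := by fun_prop
    exact this.continuousOn.smul (hT.strong_continuous x)

theorem apply_apply (hT : IsC0Semigroup T) {s t : ℝ} (hs : 0 ≤ s) (ht : 0 ≤ t) (x : E) :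
    T s (T t x) = T (s + t) x := by
  rw [hT.map_add s t hs ht]
  rfl

theorem map_nat_mul (hT : IsC0Semigroup T) {t : ℝ} (ht : 0 ≤ t) (n : ℕ) :
    T (n * t) = T t ^ n := by
  induction n with
  | zero => simp [hT.map_zero]
  | succ n ih =>
    rw [Nat.cast_succ, add_mul, one_mul, hT.map_add _ _ (by positivity) ht, ih, pow_succ]

theorem continuous_abs_apply (hT : IsC0Semigroup T) (x : E) : Continuous fun t => T |t| x :=
  (hT.strong_continuous x).comp_continuous continuous_abs fun t => abs_nonneg t

/-- The uniform bound upgrades strong continuity to joint continuity. Composing with `|·|` avoids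
the meaningless negative times, so convolution integrands become continuous on all of `ℝ`. -/
theorem continuous_uncurry_abs (hT : IsC0Semigroup T) {M : ℝ} (hM : ∀ t, 0 ≤ t → ‖T t‖ ≤ M) :
    Continuous fun p : ℝ × E => T |p.1| p.2 := by
  refine continuous_iff_continuousAt.2 fun ⟨t₀, x₀⟩ => ?_
  have h1 : Tendsto (fun p : ℝ × E => T |p.1| (p.2 - x₀)) (𝓝 (t₀, x₀)) (𝓝 0) := by
    have h2 : Tendsto (fun p : ℝ × E => M * ‖p.2 - x₀‖) (𝓝 (t₀, x₀)) (𝓝 0) := by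
      have : Continuous fun p : ℝ × E => M * ‖p.2 - x₀‖ := by fun_prop
      simpa using this.tendsto (t₀, x₀)
    exact squeeze_zero_norm (fun p => (T |p.1|).le_of_opNorm_le (hM _ (abs_nonneg _)) _) h2
  have h3 : Tendsto (fun p : ℝ × E => T |p.1| x₀) (𝓝 (t₀, x₀)) (𝓝 (T |t₀| x₀)) :=
    ((hT.continuous_abs_apply x₀).comp continuous_fst).tendsto (t₀, x₀)
  have h4 := h1.add h3
  simp only [map_sub, sub_add_cancel, zero_add] at h4
  exact h4

end IsC0Semigroup

theorem continuous_uncurry_abs_expShift (hT : Continuous fun p : ℝ × E => T |p.1| p.2) (C : ℝ) :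
    Continuous fun p : ℝ × E => expShift C T |p.1| p.2 := by
  have h : Continuous fun p : ℝ × E => Real.exp (-C * |p.1|) := by fun_prop
  exact h.smul hT

theorem norm_le_semigroupSup (hS : BddAbove ((fun t => ‖S t‖) '' Ici 0)) {t : ℝ} (ht : 0 ≤ t) :
    ‖S t‖ ≤ semigroupSup S :=
  le_csSup hS ⟨t, ht, rfl⟩

theorem semigroupSup_nonneg (hS : BddAbove ((fun t => ‖S t‖) '' Ici 0)) : 0 ≤ semigroupSup S :=
  (norm_nonneg _).trans (norm_le_semigroupSup hS le_rfl)

theorem IsPositiveSemigroup.expShift [PartialOrder E] [IsOrderedModule ℝ E]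
    (hT : IsPositiveSemigroup T) (C : ℝ) :
    IsPositiveSemigroup (expShift C T) := fun t ht x hx =>
  smul_nonneg (Real.exp_pos _).le (hT t ht x hx)

/-- `u` is a mild solution of `u' = B u + f` on `ℝ`, where `B` is the generator of `T`. -/
def IsMild (T : ℝ → E →L[ℝ] E) (f u : ℝ → E) : Prop :=
  ∀ a t : ℝ, a ≤ t → u t = T (t - a) (u a) + ∫ s in a..t, T (t - s) (f s)

theorem integral_abs_eq (T : ℝ → E →L[ℝ] E) (f : ℝ → E) {a b t : ℝ} (hab : a ≤ b) (hbt : b ≤ t) :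
    ∫ s in a..b, T |t - s| (f s) = ∫ s in a..b, T (t - s) (f s) := by
  refine intervalIntegral.integral_congr fun s hs => ?_
  rw [uIcc_of_le hab] at hs
  simp only [abs_of_nonneg (sub_nonneg.2 (hs.2.trans hbt))]

theorem inverse_apply_apply {P : E →L[ℝ] E} (hP : IsUnit P) (x : E) : Ring.inverse P (P x) = x :=
  congrArg (fun L : E →L[ℝ] E => L x) (Ring.inverse_mul_cancel P hP)

theorem apply_inverse_apply {P : E →L[ℝ] E} (hP : IsUnit P) (x : E) : P (Ring.inverse P x) = x :=
  congrArg (fun L : E →L[ℝ] E => L x) (Ring.mul_inverse_cancel P hP)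

theorem integral_eq_integral_zero (S : ℝ → E →L[ℝ] E) (g : ℝ → E) {ω : ℝ} (hω : 0 ≤ ω) (t : ℝ) :
    ∫ s in (t - ω)..t, S (t - s) (g s) = ∫ r in 0..ω, S |r| (g (t - r)) := by
  rw [← integral_abs_eq S g (by linarith) le_rfl]
  have := intervalIntegral.integral_comp_sub_left (a := 0) (b := ω)
    (fun s => S |t - s| (g s)) t
  simpa using this.symm

variable [CompleteSpace E]

theorem apply_integral (hT : IsC0Semigroup T) (hTc : Continuous fun p : ℝ × E => T |p.1| p.2)
    {f : ℝ → E} (hf : Continuous f) {r a b t : ℝ} (hr : 0 ≤ r) (hab : a ≤ b) (hbt : b ≤ t) :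
    T r (∫ s in a..b, T (t - s) (f s)) = ∫ s in a..b, T (r + t - s) (f s) := by
  rw [← integral_abs_eq T f hab hbt, ← ContinuousLinearMap.intervalIntegral_comp_comm]
  · refine intervalIntegral.integral_congr fun s hs => ?_
    rw [uIcc_of_le hab] at hs
    have hts := sub_nonneg.2 (hs.2.trans hbt)
    simp only [abs_of_nonneg hts, hT.apply_apply hr hts, add_sub_assoc]
  · exact (hTc.comp ((continuous_const.sub continuous_id).prodMk hf)).intervalIntegrable _ _

/-- The shifted formula is the fundamental theorem of calculus for `s ↦ exp (-C (t - s)) • T (t - s)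
(u s)` on `[a, t]`. -/
theorem IsMild.expShift (hT : IsC0Semigroup T) (hTc : Continuous fun p : ℝ × E => T |p.1| p.2)
    {f u : ℝ → E} (hf : Continuous f) (h : IsMild T f u) (C : ℝ) :
    IsMild (expShift C T) (fun s => f s + C • u s) u := by
  intro a t hat
  have hcont : Continuous fun s => T |t - s| (f s) :=
    hTc.comp ((continuous_const.sub continuous_id).prodMk hf)
  -- On `[a, t]` this equals `T (t - s) (u s)`; in this form it is differentiable although `u` need
  -- not be.
  set P : ℝ → E := fun s => T (t - a) (u a) + ∫ r in a..s, T |t - r| (f r) with hP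
  have hPd : ∀ s, HasDerivAt P (T |t - s| (f s)) s := fun s =>
    (hcont.integral_hasStrictDerivAt a s).hasDerivAt.const_add _
  have hPc : Continuous P := continuous_iff_continuousAt.2 fun s => (hPd s).continuousAt
  have hPu : ∀ s ∈ Icc a t, P s = T (t - s) (u s) := by
    intro s hs
    have hts := sub_nonneg.2 hs.2
    rw [h a s hs.1, map_add, hT.apply_apply hts (sub_nonneg.2 hs.1),
      apply_integral hT hTc hf hts hs.1 le_rfl, hP]
    simp only [sub_add_sub_cancel, sub_add_cancel]
    rw [integral_abs_eq T f hs.1 hs.2]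
  have he : Continuous fun s => Real.exp (-C * (t - s)) := by fun_prop
  have hd : ∀ s, HasDerivAt (fun s => Real.exp (-C * (t - s)) • P s)
      (Real.exp (-C * (t - s)) • (T |t - s| (f s) + C • P s)) s := by
    intro s
    have he : HasDerivAt (fun s => Real.exp (-C * (t - s)))
        (Real.exp (-C * (t - s)) * C) s := by
      have := (((hasDerivAt_id s).const_sub t).const_mul (-C)).exp
      simpa using this
    have := he.smul (hPd s)
    rw [smul_add, smul_smul]
    exact this
  have hint := intervalIntegral.integral_eq_sub_of_hasDerivAt (a := a) (b := t)
    (fun s _ => hd s) (Continuous.intervalIntegrable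
      (he.smul (hcont.add (hPc.const_smul C))) _ _)
  have hcongr : ∫ s in a..t, Real.exp (-C * (t - s)) • (T |t - s| (f s) + C • P s) =
      ∫ s in a..t, DelayEvolution.expShift C T (t - s) (f s + C • u s) := by
    refine intervalIntegral.integral_congr fun s hs => ?_
    rw [uIcc_of_le hat] at hs
    simp only [expShift_apply, hPu s hs, abs_of_nonneg (sub_nonneg.2 hs.2), map_add, smul_add,
      map_smul]
    rw [smul_comm C]
  rw [← hcongr, hint, hPu a ⟨le_rfl, hat⟩, hPu t ⟨hat, le_rfl⟩, expShift_apply]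
  simp [hT.map_zero]

/-- The shift by `-C` undoes the shift by `C`, so one implication gives both. -/
theorem isMild_expShift_iff (hT : IsC0Semigroup T)
    (hTc : Continuous fun p : ℝ × E => T |p.1| p.2) {f u : ℝ → E} (hf : Continuous f)
    (hu : Continuous u) (C : ℝ) :
    IsMild (expShift C T) (fun s => f s + C • u s) u ↔ IsMild T f u := by
  refine ⟨fun h => ?_, fun h => h.expShift hT hTc hf C⟩
  have := IsMild.expShift (hT.expShift C) (continuous_uncurry_abs_expShift hTc C)
    (hf.add (hu.const_smul C)) h (-C)
  simpa [expShift_neg_expShift] using this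

/-- The periodic mild solutions of `u' = B u + g` are given by the periodic resolvent formula. -/
theorem isMild_iff_eq_inverse_integral (hS : IsC0Semigroup S)
    (hSc : Continuous fun p : ℝ × E => S |p.1| p.2) {ω : ℝ} (hω : 0 ≤ ω)
    (hunit : IsUnit (1 - S ω)) {g u : ℝ → E} (hg : Continuous g) (hgp : Function.Periodic g ω)
    (hup : Function.Periodic u ω) :
    IsMild S g u ↔
      u = fun t => Ring.inverse (1 - S ω) (∫ s in (t - ω)..t, S (t - s) (g s)) := by
  refine ⟨fun h => funext fun t => ?_, fun h a t hat => ?_⟩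
  · have h1 := h (t - ω) t (by linarith)
    rw [sub_sub_cancel, hup.sub_eq] at h1
    have h2 : ∫ s in (t - ω)..t, S (t - s) (g s) = (1 - S ω) (u t) := by
      rw [_root_.sub_apply, one_apply_eq_self, eq_sub_iff_add_eq,
        add_comm, ← h1]
    rw [h2, inverse_apply_apply hunit]
  · have hI : ∀ t, (1 - S ω) (u t) = ∫ s in (t - ω)..t, S (t - s) (g s) := fun t => by
      rw [congrFun h t, apply_inverse_apply hunit]
    have hint : ∀ a b, IntervalIntegrable (fun s => S |t - s| (g s)) volume a b := fun a b =>
      (hSc.comp ((continuous_const.sub continuous_id).prodMk hg)).intervalIntegrable _ _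
    have hta := sub_nonneg.2 hat
    have hcomm : (1 - S ω) (S (t - a) (u a)) = S (t - a) ((1 - S ω) (u a)) := by
      simp only [_root_.sub_apply, one_apply_eq_self, map_sub,
        hS.apply_apply hω hta, hS.apply_apply hta hω, add_comm]
    have hinj : Function.Injective ((1 - S ω : E →L[ℝ] E) : E → E) := fun x y hxy => by
      rw [← inverse_apply_apply hunit x, hxy, inverse_apply_apply hunit]
    have h1 : S (t - a) (∫ s in (a - ω)..a, S (a - s) (g s)) =
        ∫ s in (a - ω)..a, S |t - s| (g s) := by
      rw [apply_integral hS hSc hg hta (by linarith) le_rfl, sub_add_cancel,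
        integral_abs_eq S g (by linarith) hat]
    have h2 : S ω (∫ s in a..t, S (t - s) (g s)) =
        ∫ s in (a - ω)..(t - ω), S |t - s| (g s) := by
      rw [apply_integral hS hSc hg hω hat le_rfl, integral_abs_eq S g (by linarith) (by linarith),
        ← intervalIntegral.integral_comp_sub_right (fun s => S (t - s) (g s)) ω]
      refine intervalIntegral.integral_congr fun s _ => ?_
      simp only [hgp.sub_eq]
      congr 2
      ring
    -- Under `1 - S ω` the claim becomes, for the common integrand `S (t - s) (g s)`, the identity
    -- `∫_{t-ω}^t = ∫_{a-ω}^a + ∫_a^t - ∫_{a-ω}^{t-ω}`.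
    apply hinj
    rw [map_add, hcomm, hI, hI, h1, _root_.sub_apply,
      one_apply_eq_self, h2, ← integral_abs_eq S g (by linarith) le_rfl,
      ← integral_abs_eq S g hat le_rfl]
    rw [← intervalIntegral.integral_add_adjacent_intervals (hint (t - ω) a) (hint a t),
      ← intervalIntegral.integral_add_adjacent_intervals (hint (a - ω) (t - ω)) (hint (t - ω) a)]
    abel

/-- The function `s ↦ T (t - s) (v s)` has derivative `T (t - s) (v' + A v)`, which is then
integrated. The generator is a limit from the right, so only the right derivative is computed; with
continuity this suffices. -/
theorem isMild_of_isRegularPeriodic (hT : IsC0Semigroup T)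
    (hTc : Continuous fun p : ℝ × E => T |p.1| p.2) {A : E →ₗ.[ℝ] E} (hA : IsGenerator T (-A))
    {ω : ℝ} {v : ℝ → E} (hv : IsRegularPeriodic A ω v) :
    IsMild T (fun t => deriv v t + A ⟨v t, hv.mem_domain t⟩) v := by
  intro a t hat
  set f : ℝ → E := fun t => deriv v t + A ⟨v t, hv.mem_domain t⟩ with hf
  have hfc : Continuous f := (hv.contDiff.continuous_deriv le_rfl).add hv.continuous_apply
  have hcont : Continuous fun s => T |t - s| (f s) :=
    hTc.comp ((continuous_const.sub continuous_id).prodMk hfc)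
  have hψ : Continuous fun s => T |t - s| (v s) :=
    hTc.comp ((continuous_const.sub continuous_id).prodMk hv.contDiff.continuous)
  have hd : ∀ s ∈ Ioo (min a t) (max a t),
      HasDerivWithinAt (fun s => T |t - s| (v s)) (T |t - s| (f s)) (Ioi s) s := by
    intro s hs
    rw [min_eq_left hat, max_eq_right hat] at hs
    rw [hasDerivWithinAt_iff_tendsto_slope' self_notMem_Ioi]
    have hgen : Tendsto (fun h : ℝ => h⁻¹ • (T h (v s) - v s)) (𝓝[>] 0)
        (𝓝 (-A ⟨v s, hv.mem_domain s⟩)) :=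
      (hA _ _).1 ((-A).mem_graph ⟨v s, hv.mem_domain s⟩)
    have hshift : Tendsto (fun r => r - s) (𝓝[>] s) (𝓝[>] 0) := by
      refine tendsto_nhdsWithin_iff.2 ⟨?_, ?_⟩
      · have : Continuous fun r : ℝ => r - s := by fun_prop
        simpa using (this.tendsto s).mono_left nhdsWithin_le_nhds
      · filter_upwards [self_mem_nhdsWithin] with r hr using mem_Ioi.2 (sub_pos.2 hr)
    have hslope : Tendsto (slope v s) (𝓝[>] s) (𝓝 (deriv v s)) :=
      (hasDerivAt_iff_tendsto_slope.1
        ((hv.contDiff.differentiable one_ne_zero) s).hasDerivAt).mono_left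
          (nhdsWithin_mono _ fun r hr => ne_of_gt hr)
    have harg := hslope.sub (hgen.comp hshift)
    rw [sub_neg_eq_add] at harg
    have hid : Tendsto (fun r => t - r) (𝓝[>] s) (𝓝 (t - s)) :=
      ((continuous_const.sub continuous_id).tendsto s).mono_left nhdsWithin_le_nhds
    have hlim := (hTc.tendsto (t - s, f s)).comp (hid.prodMk_nhds harg)
    -- The difference quotient is `T (t - r)` applied to the slope of `v` minus the quotient `(T (r
    -- - s) (v s) - v s) / (r - s)`.
    refine hlim.congr' ?_
    filter_upwards [Ioo_mem_nhdsGT hs.2] with r hr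
    have htr : 0 ≤ t - r := sub_nonneg.2 hr.2.le
    have hrs : 0 ≤ r - s := sub_nonneg.2 hr.1.le
    have hsplit : T |t - s| (v s) = T |t - r| (T (r - s) (v s)) := by
      rw [abs_of_nonneg htr, hT.apply_apply htr hrs, sub_add_sub_cancel,
        abs_of_nonneg (sub_nonneg.2 hs.2.le)]
    simp only [Function.comp_apply, slope_def_module, hsplit, ← map_sub, ← map_smul, ← smul_sub]
    congr 2
    abel
  have hint := intervalIntegral.integral_eq_sub_of_hasDeriv_right hψ.continuousOn hd
    (hcont.intervalIntegrable _ _)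
  rw [integral_abs_eq T f hat le_rfl] at hint
  simp only [sub_self, abs_zero, abs_of_nonneg (sub_nonneg.2 hat), hT.map_zero,
    one_apply_eq_self] at hint
  rw [hint]
  abel

end Semigroup

/-! ### Positivity of the resolvent formula. -/

section Positive

variable {E : Type*} [NormedAddCommGroup E] [NormedSpace ℝ E]
  [PartialOrder E] [IsOrderedAddMonoid E] [IsOrderedModule ℝ E] [OrderClosedTopology E]

theorem integral_semigroup_mono {S : ℝ → E →L[ℝ] E} (hpos : IsPositiveSemigroup S)
    (hSc : Continuous fun p : ℝ × E => S |p.1| p.2) {f g : ℝ → E} (hf : Continuous f)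
    (hg : Continuous g) (hfg : f ≤ g) {a t : ℝ} (hat : a ≤ t) :
    ∫ s in a..t, S (t - s) (f s) ≤ ∫ s in a..t, S (t - s) (g s) := by
  have hint : ∀ {h : ℝ → E}, Continuous h →
      IntegrableOn (fun s => S |t - s| (h s)) (Ioc a t) volume := fun hh =>
    ((hSc.comp ((continuous_const.sub continuous_id).prodMk hh)).intervalIntegrable a t).1
  rw [← integral_abs_eq S f hat le_rfl, ← integral_abs_eq S g hat le_rfl,
    intervalIntegral.integral_of_le hat, intervalIntegral.integral_of_le hat]
  refine integral_mono (hint hf) (hint hg) fun s => ?_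
  have := hpos |t - s| (abs_nonneg _) _ (sub_nonneg.2 (hfg s))
  rwa [map_sub, sub_nonneg] at this

variable [CompleteSpace E]

/-- If `P` is positive and power bounded and `1 - P` is invertible, then its inverse is positive. -/
theorem inverse_one_sub_apply_nonneg {P : E →L[ℝ] E} (hP : ∀ x, 0 ≤ x → 0 ≤ P x) {M : ℝ}
    (hM : ∀ n : ℕ, ‖P ^ n‖ ≤ M) (hunit : IsUnit (1 - P)) {x : E} (hx : 0 ≤ x) :
    0 ≤ Ring.inverse (1 - P) x := by
  have hPn : ∀ n : ℕ, 0 ≤ (P ^ n) x := fun n => by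
    induction n with
    | zero => simpa using hx
    | succ n ih =>
      rw [pow_succ']
      exact hP _ ih
  -- Power boundedness gives a convergent Neumann series only for `q • P` with `q < 1`; continuity
  -- of inversion at the unit `1 - P` then allows `q → 1`.
  have hq : ∀ q ∈ Ioo (0 : ℝ) 1, 0 ≤ Ring.inverse (1 - q • P) x := by
    intro q hq
    have hsum : Summable fun n : ℕ => (q • P) ^ n := by
      refine Summable.of_norm_bounded (g := fun n => q ^ n * M)
        ((summable_geometric_of_lt_one hq.1.le hq.2).mul_right M) fun n => ?_
      rw [smul_pow, norm_smul, Real.norm_of_nonneg (pow_nonneg hq.1.le n)]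
      exact mul_le_mul_of_nonneg_left (hM n) (pow_nonneg hq.1.le n)
    have hinv : Ring.inverse (1 - q • P) = ∑' n : ℕ, (q • P) ^ n := by
      have h1 := hsum.one_sub_mul_tsum_pow
      have h2 := hsum.tsum_pow_mul_one_sub
      exact Ring.inverse_unit (⟨1 - q • P, _, h1, h2⟩ : (E →L[ℝ] E)ˣ)
    rw [hinv]
    have happ : (∑' n : ℕ, (q • P) ^ n) x = ∑' n : ℕ, ((q • P) ^ n) x :=
      ((ContinuousLinearMap.apply ℝ E x).map_tsum hsum)
    rw [happ]
    refine tsum_nonneg fun n => ?_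
    rw [smul_pow]
    exact smul_nonneg (pow_nonneg hq.1.le n) (hPn n)
  have hcont : Tendsto (fun q : ℝ => Ring.inverse (1 - q • P) x) (𝓝[<] 1)
      (𝓝 (Ring.inverse (1 - P) x)) := by
    obtain ⟨U, hU⟩ := hunit
    have h1 : Tendsto (fun q : ℝ => 1 - q • P) (𝓝[<] 1) (𝓝 (U : E →L[ℝ] E)) := by
      have : Continuous fun q : ℝ => 1 - q • P := by fun_prop
      rw [hU]
      simpa using (this.tendsto 1).mono_left nhdsWithin_le_nhds
    have h2 := (NormedRing.inverse_continuousAt U).tendsto.comp h1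
    rw [hU] at h2
    exact ((ContinuousLinearMap.apply ℝ E x).continuous.tendsto _).comp h2
  refine ge_of_tendsto hcont ?_
  filter_upwards [Ioo_mem_nhdsLT zero_lt_one] with q using hq q

theorem inverse_one_sub_map_mono {S : ℝ → E →L[ℝ] E} (hS : IsC0Semigroup S)
    (hpos : IsPositiveSemigroup S) {M : ℝ} (hM : ∀ t, 0 ≤ t → ‖S t‖ ≤ M) {ω : ℝ} (hω : 0 ≤ ω)
    (hunit : IsUnit (1 - S ω)) : Monotone (Ring.inverse (1 - S ω) : E →L[ℝ] E) := by
  intro x y hxy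
  have := inverse_one_sub_apply_nonneg (hpos ω hω) (M := M)
    (fun n => by rw [← hS.map_nat_mul hω]; exact hM _ (by positivity)) hunit (sub_nonneg.2 hxy)
  rwa [map_sub, sub_nonneg] at this

end Positive

/-! ### The shifted nonlinearity and the iteration operator. -/

theorem exists_forall_norm_le_of_periodic {E : Type*} [NormedAddCommGroup E] {f : ℝ → E} {ω : ℝ}
    (hf : Continuous f) (hfp : Function.Periodic f ω) (hω : 0 < ω) :
    ∃ B : ℝ, 0 ≤ B ∧ ∀ t, ‖f t‖ ≤ B := by
  obtain ⟨B, hB⟩ := (hfp.isBounded_of_continuous hω.ne' hf).exists_norm_le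
  exact ⟨B, (norm_nonneg _).trans (hB _ ⟨0, rfl⟩), fun t => hB _ ⟨t, rfl⟩⟩

theorem continuous_delayTerm {E : Type*} [NormedAddCommGroup E] {F : ℝ → E → E → E}
    (hF : Continuous fun p : ℝ × E × E => F p.1 p.2.1 p.2.2)
    (τ : ℝ) {u : ℝ → E} (hu : Continuous u) : Continuous fun t => F t (u t) (u (t - τ)) :=
  hF.comp (continuous_id.prodMk
    (hu.prodMk (hu.comp (continuous_id.sub continuous_const))))

/-- The nonlinearity `t ↦ F(t, u(t), u(t - τ)) + C u(t)` of the shifted equation. -/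
def shiftedTerm {E : Type*} [NormedAddCommGroup E] [NormedSpace ℝ E] (F : ℝ → E → E → E)
    (τ C : ℝ) (u : ℝ → E) : ℝ → E :=
  fun t => F t (u t) (u (t - τ)) + C • u t

section ShiftedTerm

variable {E : Type*} [NormedAddCommGroup E] [NormedSpace ℝ E] {F : ℝ → E → E → E} {ω τ C : ℝ}

theorem continuous_shiftedTerm (hF : Continuous fun p : ℝ × E × E => F p.1 p.2.1 p.2.2)
    (τ C : ℝ) {u : ℝ → E} (hu : Continuous u) : Continuous (shiftedTerm F τ C u) :=
  (continuous_delayTerm hF τ hu).add (hu.const_smul C)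

theorem tendsto_shiftedTerm (hF : Continuous fun p : ℝ × E × E => F p.1 p.2.1 p.2.2)
    (τ C : ℝ) {x : ℕ → ℝ → E} {u : ℝ → E}
    (hx : ∀ t, Tendsto (fun n => x n t) atTop (𝓝 (u t))) (t : ℝ) :
    Tendsto (fun n => shiftedTerm F τ C (x n) t) atTop (𝓝 (shiftedTerm F τ C u t)) := by
  have h := (tendsto_const_nhds (x := t)).prodMk_nhds ((hx t).prodMk_nhds (hx (t - τ)))
  exact ((hF.tendsto (t, u t, u (t - τ))).comp h).add ((hx t).const_smul C)

theorem periodic_shiftedTerm (hF : ∀ x y : E, Function.Periodic (fun t => F t x y) ω)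
    (τ C : ℝ) {u : ℝ → E} (hu : Function.Periodic u ω) :
    Function.Periodic (shiftedTerm F τ C u) ω := by
  intro t
  have h : u (t + ω - τ) = u (t - τ) := by rw [add_sub_right_comm, hu]
  simp only [shiftedTerm, hu t, h]
  exact congrArg (· + C • u t) (hF (u t) (u (t - τ)) t)

theorem iterOp_apply (T : ℝ → E →L[ℝ] E) (F : ℝ → E → E → E) (ω τ C : ℝ) (u : ℝ → E) (t : ℝ) :
    iterOp T F ω τ C u t = Ring.inverse (1 - expShift C T ω)
      (∫ s in (t - ω)..t, expShift C T (t - s) (shiftedTerm F τ C u s)) := rfl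

theorem continuous_iterOp {T : ℝ → E →L[ℝ] E}
    (hS : Continuous fun p : ℝ × E => expShift C T |p.1| p.2) (hω : 0 ≤ ω)
    {u : ℝ → E} (hu : Continuous (shiftedTerm F τ C u)) : Continuous (iterOp T F ω τ C u) := by
  have h : Continuous fun t => ∫ r in 0..ω, expShift C T |r| (shiftedTerm F τ C u (t - r)) := by
    refine intervalIntegral.continuous_parametric_intervalIntegral_of_continuous' ?_ 0 ω
    exact hS.comp (continuous_snd.prodMk (hu.comp (continuous_fst.sub continuous_snd)))
  have heq : iterOp T F ω τ C u = fun t => Ring.inverse (1 - expShift C T ω)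
      (∫ r in 0..ω, expShift C T |r| (shiftedTerm F τ C u (t - r))) := by
    funext t
    rw [iterOp_apply, integral_eq_integral_zero _ _ hω]
  rw [heq]
  exact (Ring.inverse (1 - expShift C T ω) : E →L[ℝ] E).continuous.comp h

theorem periodic_iterOp (T : ℝ → E →L[ℝ] E) (hω : 0 ≤ ω) {u : ℝ → E}
    (hu : Function.Periodic (shiftedTerm F τ C u) ω) :
    Function.Periodic (iterOp T F ω τ C u) ω := by
  intro t
  rw [iterOp_apply, iterOp_apply, integral_eq_integral_zero _ _ hω,
    integral_eq_integral_zero _ _ hω]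
  simp only [add_sub_right_comm, hu _]

/-- Periodicity moves the window `[t - ω, t]` to `[0, ω]`, so the bound does not depend on `t`. This
is what turns pointwise convergence of the nonlinear terms into uniform convergence of the iterates.
-/
theorem norm_iterOp_sub_le {T : ℝ → E →L[ℝ] E}
    (hS : Continuous fun p : ℝ × E => expShift C T |p.1| p.2)
    {M : ℝ} (hM : ∀ t, 0 ≤ t → ‖expShift C T t‖ ≤ M) (hω : 0 ≤ ω) {u v : ℝ → E}
    (hu : Continuous (shiftedTerm F τ C u)) (hv : Continuous (shiftedTerm F τ C v))
    (hup : Function.Periodic (shiftedTerm F τ C u) ω)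
    (hvp : Function.Periodic (shiftedTerm F τ C v) ω) (t : ℝ) :
    ‖iterOp T F ω τ C u t - iterOp T F ω τ C v t‖ ≤ resolventConst (expShift C T) ω *
      (M * ∫ s in 0..ω, ‖shiftedTerm F τ C u s - shiftedTerm F τ C v s‖) := by
  have hcont : ∀ {g : ℝ → E}, Continuous g → Continuous fun s => expShift C T |t - s| (g s) :=
    fun hg => hS.comp ((continuous_const.sub continuous_id).prodMk hg)
  rw [iterOp_apply, iterOp_apply, ← map_sub, ← integral_abs_eq _ _ (by linarith) le_rfl,
    ← integral_abs_eq _ _ (by linarith) le_rfl, ← intervalIntegral.integral_sub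
      ((hcont hu).intervalIntegrable _ _) ((hcont hv).intervalIntegrable _ _)]
  refine (ContinuousLinearMap.le_opNorm _ _).trans
    (mul_le_mul_of_nonneg_left ?_ (norm_nonneg _))
  have hper : Function.Periodic
      (fun s => ‖shiftedTerm F τ C u s - shiftedTerm F τ C v s‖) ω := fun s => by
    simp only [hup s, hvp s]
  have hshift := hper.intervalIntegral_add_eq (t - ω) 0
  rw [sub_add_cancel, zero_add] at hshift
  rw [← hshift, ← intervalIntegral.integral_const_mul]
  refine intervalIntegral.norm_integral_le_of_norm_le (by linarith) ?_
    (Continuous.intervalIntegrable (by fun_prop) _ _)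
  refine Eventually.of_forall fun s _ => ?_
  rw [← map_sub]
  exact ContinuousLinearMap.le_of_opNorm_le _ (hM _ (abs_nonneg _)) _

theorem isPeriodicMildSolution_iff [CompleteSpace E] {T : ℝ → E →L[ℝ] E} (hT : IsC0Semigroup T)
    (hTc : Continuous fun p : ℝ × E => T |p.1| p.2) (hω : 0 ≤ ω)
    (hunit : IsUnit (1 - expShift C T ω))
    (hF : Continuous fun p : ℝ × E × E => F p.1 p.2.1 p.2.2)
    (hFp : ∀ x y : E, Function.Periodic (fun t => F t x y) ω) {u : ℝ → E}
    (hu : Continuous u) (hup : Function.Periodic u ω) :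
    IsPeriodicMildSolution T F ω τ u ↔ iterOp T F ω τ C u = u := by
  have h1 := isMild_expShift_iff hT hTc (continuous_delayTerm hF τ hu) hu C
  have h2 := isMild_iff_eq_inverse_integral (hT.expShift C)
    (continuous_uncurry_abs_expShift hTc C) hω hunit (continuous_shiftedTerm hF τ C hu)
    (periodic_shiftedTerm hFp τ C hup) hup
  rw [eq_comm]
  exact ⟨fun h => h2.1 (h1.2 h.eq), fun h => ⟨hu, hup, h1.1 (h2.2 h)⟩⟩

/-- The term `C • u` exactly compensates the one-sided bound in (H1). -/
theorem shiftedTerm_mono [PartialOrder E] [IsOrderedAddMonoid E] {v₀ w₀ : ℝ → E}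
    (H1 : ∀ (t : ℝ) (x₁ x₂ y₁ y₂ : E), v₀ t ≤ x₁ → x₁ ≤ x₂ → x₂ ≤ w₀ t →
      v₀ (t - τ) ≤ y₁ → y₁ ≤ y₂ → y₂ ≤ w₀ (t - τ) →
      -(C • (x₂ - x₁)) ≤ F t x₂ y₂ - F t x₁ y₁)
    {u v : ℝ → E} (hu : v₀ ≤ u) (huv : u ≤ v) (hv : v ≤ w₀) :
    shiftedTerm F τ C u ≤ shiftedTerm F τ C v := by
  intro t
  have h := H1 t _ _ _ _ (hu t) (huv t) (hv t) (hu _) (huv (t - τ)) (hv _)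
  rw [← sub_nonneg] at h ⊢
  convert h using 1
  simp only [shiftedTerm, smul_sub]
  abel

end ShiftedTerm

/-! ### Convergence of the monotone iteration. -/

section MonotoneIteration

variable {E : Type*} [NormedAddCommGroup E] [NormedSpace ℝ E] [CompleteSpace E]
  [PartialOrder E] [IsOrderedAddMonoid E] [OrderClosedTopology E]
  {T : ℝ → E →L[ℝ] E} {F : ℝ → E → E → E} {ω τ C : ℝ} {v₀ w₀ : ℝ → E}

theorem iterOp_mono [IsOrderedModule ℝ E] (hS : IsC0Semigroup (expShift C T))
    (hpos : IsPositiveSemigroup (expShift C T))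
    {M : ℝ} (hM : ∀ t, 0 ≤ t → ‖expShift C T t‖ ≤ M) (hω : 0 ≤ ω)
    (hunit : IsUnit (1 - expShift C T ω)) {u v : ℝ → E}
    (hu : Continuous (shiftedTerm F τ C u)) (hv : Continuous (shiftedTerm F τ C v))
    (huv : shiftedTerm F τ C u ≤ shiftedTerm F τ C v) :
    iterOp T F ω τ C u ≤ iterOp T F ω τ C v := fun t =>
  inverse_one_sub_map_mono hS hpos hM hω hunit
    (integral_semigroup_mono hpos (hS.continuous_uncurry_abs hM) hu hv huv (by linarith))

/-- A monotone sequence of iterates in the order interval converges uniformly to a fixed point. -/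
theorem exists_tendstoUniformly_iterOp (hK : HasNormalCone E)
    (hSc : Continuous fun p : ℝ × E => expShift C T |p.1| p.2)
    (hbdd : BddAbove ((fun t => ‖expShift C T t‖) '' Ici 0)) (hω : 0 < ω)
    (hF : Continuous fun p : ℝ × E × E => F p.1 p.2.1 p.2.2)
    (hFp : ∀ x y : E, Function.Periodic (fun t => F t x y) ω)
    (hv₀ : Continuous v₀) (hv₀p : Function.Periodic v₀ ω)
    (hw₀ : Continuous w₀) (hw₀p : Function.Periodic w₀ ω)
    (H1 : ∀ (t : ℝ) (x₁ x₂ y₁ y₂ : E), v₀ t ≤ x₁ → x₁ ≤ x₂ → x₂ ≤ w₀ t →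
      v₀ (t - τ) ≤ y₁ → y₁ ≤ y₂ → y₂ ≤ w₀ (t - τ) →
      -(C • (x₂ - x₁)) ≤ F t x₂ y₂ - F t x₁ y₁)
    {c : ℝ} (hc : 0 ≤ c)
    (hc_lt : c * (4 * ω * resolventConst (expShift C T) ω * semigroupSup (expShift C T)) < 1)
    (H2 : ∀ (t : ℝ) (u : ℕ → ℝ → E), (∀ n, u n ∈ periodicIcc ω v₀ w₀) →
      (Monotone u ∨ Antitone u) →
      kuratowski (range fun n => F t (u n t) (u n (t - τ)) + C • u n t) ≤
        ENNReal.ofReal c * (kuratowski (range fun n => u n t) +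
          kuratowski (range fun n => u n (t - τ))))
    {x : ℕ → ℝ → E} (hx : ∀ n, x n ∈ periodicIcc ω v₀ w₀) (hxm : Monotone x ∨ Antitone x)
    (hxs : ∀ n, x (n + 1) = iterOp T F ω τ C (x n)) :
    ∃ u ∈ periodicIcc ω v₀ w₀, iterOp T F ω τ C u = u ∧ TendstoUniformly x u atTop := by
  obtain ⟨N, hN0, hN⟩ := hK.exists_pos
  set M := semigroupSup (expShift C T) with hMdef
  have hM0 : 0 ≤ M := semigroupSup_nonneg hbdd
  have hM : ∀ t, 0 ≤ t → ‖expShift C T t‖ ≤ M := fun t ht => norm_le_semigroupSup hbdd ht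
  have hvw : v₀ ≤ w₀ := (hx 0).2.2.1.trans (hx 0).2.2.2
  set R : E →L[ℝ] E := Ring.inverse (1 - expShift C T ω) with hR
  have hgc : ∀ n, Continuous (shiftedTerm F τ C (x n)) := fun n =>
    continuous_shiftedTerm hF τ C (hx n).1
  have hgp : ∀ n, Function.Periodic (shiftedTerm F τ C (x n)) ω := fun n =>
    periodic_shiftedTerm hFp τ C (hx n).2.1
  -- Each term lies in order between those of `v₀` and `w₀`, so normality bounds it uniformly.
  obtain ⟨B₁, hB₁0, hB₁⟩ : ∃ B : ℝ, 0 ≤ B ∧ ∀ n s, ‖shiftedTerm F τ C (x n) s‖ ≤ B := by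
    have hvc := continuous_shiftedTerm hF τ C hv₀
    have hvp := periodic_shiftedTerm hFp τ C hv₀p
    obtain ⟨a, ha0, ha⟩ := exists_forall_norm_le_of_periodic hvc hvp hω
    obtain ⟨b, hb0, hb⟩ := exists_forall_norm_le_of_periodic
      ((continuous_shiftedTerm hF τ C hw₀).sub hvc)
      ((periodic_shiftedTerm hFp τ C hw₀p).sub hvp) hω
    refine ⟨N * b + a, by positivity, fun n s => ?_⟩
    have h1 := norm_sub_le_of_mem_Icc hN
      (shiftedTerm_mono (F := F) (τ := τ) H1 le_rfl (hx n).2.2.1 (hx n).2.2.2 s)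
      (shiftedTerm_mono (F := F) (τ := τ) H1 (hx n).2.2.1 (hx n).2.2.2 le_rfl s)
    have h2 : N * ‖shiftedTerm F τ C w₀ s - shiftedTerm F τ C v₀ s‖ ≤ N * b :=
      mul_le_mul_of_nonneg_left (hb s) hN0.le
    have h3 := norm_le_norm_sub_add (shiftedTerm F τ C (x n) s) (shiftedTerm F τ C v₀ s)
    linarith [ha s]
  -- the measure of noncompactness of `{x n t}` vanishes for all `t`
  have hzero : ∀ t, kuratowski (range fun n => x n t) = 0 := by
    -- The supremum over all times dominates the values at `t` and at `t - τ` alike, which absorbs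
    -- the delay.
    set κ : ℝ≥0∞ := ⨆ t, kuratowski (range fun n => x n t) with hκ
    have hκt : ∀ t, kuratowski (range fun n => x n t) ≤ κ := fun t =>
      le_iSup (fun t => kuratowski (range fun n => x n t)) t
    -- Finiteness is needed to conclude `κ = 0` from `κ ≤ q κ` with `q < 1`.
    have hκ_top : κ ≠ ⊤ := by
      obtain ⟨b, hb0, hb⟩ := exists_forall_norm_le_of_periodic (hw₀.sub hv₀) (hw₀p.sub hv₀p) hω
      refine ne_top_of_le_ne_top (b := 2 * ENNReal.ofReal (N * b)) (by simp [ENNReal.mul_eq_top])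
        (iSup_le fun t => ?_)
      refine (kuratowski_mono (B' := Metric.closedEBall (v₀ t) (ENNReal.ofReal (N * b))) ?_).trans
        ((kuratowski_le_ediam _).trans Metric.ediam_closedEBall_le)
      rintro _ ⟨n, rfl⟩
      rw [Metric.mem_closedEBall, edist_dist, dist_eq_norm]
      exact ENNReal.ofReal_le_ofReal ((norm_sub_le_of_mem_Icc hN ((hx n).2.2.1 t)
        ((hx n).2.2.2 t)).trans (mul_le_mul_of_nonneg_left (hb t) hN0.le))
    have hgκ : ∀ s, kuratowski (range fun n => shiftedTerm F τ C (x n) s) ≤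
        ENNReal.ofReal c * (κ + κ) := fun s =>
      (H2 s x hx hxm).trans (mul_le_mul_right (add_le_add (hκt _) (hκt _)) _)
    have hstep : ∀ t, kuratowski (range fun n => x n t) ≤
        ‖R‖₊ * (2 * (ENNReal.ofReal (ω - 0) *
          (ENNReal.ofReal M * (ENNReal.ofReal c * (κ + κ))))) := by
      intro t
      -- Dropping the initial term does not affect noncompactness, and all remaining terms are
      -- values of `Q`.
      have hrange : (range fun n => x n t) ⊆ insert (x 0 t) (range fun n => x (n + 1) t) := by
        rintro _ ⟨_ | n, rfl⟩
        · exact Or.inl rfl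
        · exact Or.inr ⟨n, rfl⟩
      refine (kuratowski_mono hrange).trans ((kuratowski_insert_le _ _).trans ?_)
      have hx1 : ∀ n, x (n + 1) t =
          R (∫ r in 0..ω, expShift C T |r| (shiftedTerm F τ C (x n) (t - r))) := fun n => by
        rw [hxs, iterOp_apply, integral_eq_integral_zero _ _ hω.le]
      simp only [hx1]
      refine (kuratowski_range_comp_le R.lipschitz _).trans (mul_le_mul_right ?_ _)
      refine kuratowski_range_integral_le (M := M * B₁) (fun n => ?_) hω.le (fun n r _ => ?_)
        fun r _ => ?_
      · exact hSc.comp (continuous_id.prodMk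
          ((hgc n).comp (continuous_const.sub continuous_id)))
      · exact (ContinuousLinearMap.le_of_opNorm_le _ (hM _ (abs_nonneg r)) _).trans
          (mul_le_mul_of_nonneg_left (hB₁ _ _) hM0)
      · refine (kuratowski_range_comp_le (expShift C T |r|).lipschitz _).trans
          (mul_le_mul' ?_ (hgκ _))
        rw [← ENNReal.ofReal_coe_nnreal]
        exact ENNReal.ofReal_le_ofReal (hM _ (abs_nonneg r))
    have hκ_le : κ ≤ ‖R‖₊ * (2 * (ENNReal.ofReal (ω - 0) *
          (ENNReal.ofReal M * (ENNReal.ofReal c * (κ + κ))))) := iSup_le hstep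
    have hκ0 : κ = 0 := by
      lift κ to ℝ≥0 using hκ_top with k
      have hreal := ENNReal.toReal_mono (by simp [ENNReal.mul_eq_top]) hκ_le
      simp only [sub_zero, ENNReal.coe_toReal, ENNReal.toReal_mul, coe_nnnorm,
        ENNReal.toReal_ofNat, ENNReal.toReal_ofReal hω.le, ENNReal.toReal_ofReal hM0,
        ENNReal.toReal_ofReal hc, ENNReal.toReal_add ENNReal.coe_ne_top ENNReal.coe_ne_top]
        at hreal
      have hRc : ‖R‖ = resolventConst (expShift C T) ω := rfl
      rw [hRc] at hreal
      have hk : (k : ℝ) * (1 - c * (4 * ω * resolventConst (expShift C T) ω * M)) ≤ 0 := by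
        linarith
      have hk0 : (k : ℝ) ≤ 0 := nonpos_of_mul_nonpos_left hk (by linarith)
      exact_mod_cast le_antisymm hk0 k.2
    exact fun t => le_antisymm (hκ0 ▸ hκt t) zero_le
  have hcauchy : ∀ t, CauchySeq fun n => x n t := fun t => hxm.elim
    (fun h => cauchySeq_of_monotone_of_kuratowski_eq_zero hK (fun m n hmn => h hmn t) (hzero t))
    (fun h => cauchySeq_of_antitone_of_kuratowski_eq_zero hK (fun m n hmn => h hmn t) (hzero t))
  choose u hu using fun t => cauchySeq_tendsto_of_complete (hcauchy t)
  set g := shiftedTerm F τ C u with hg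
  have hgt : ∀ s, Tendsto (fun n => shiftedTerm F τ C (x n) s) atTop (𝓝 (g s)) :=
    tendsto_shiftedTerm hF τ C hu
  have hgB : ∀ s, ‖g s‖ ≤ B₁ := fun s =>
    le_of_tendsto (hgt s).norm (Eventually.of_forall fun n => hB₁ n s)
  -- Continuity of `u` is not yet known, so `g` is handled only as a bounded measurable limit.
  have hgm : StronglyMeasurable g := stronglyMeasurable_of_tendsto atTop
    (fun n => (hgc n).stronglyMeasurable) (tendsto_pi_nhds.2 hgt)
  set D : ℕ → ℝ := fun n => ∫ s in 0..ω, ‖shiftedTerm F τ C (x n) s - g s‖ with hD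
  have hbd : ∀ n s, ‖shiftedTerm F τ C (x n) s - g s‖ ≤ 2 * B₁ := fun n s => by
    linarith [norm_sub_le (shiftedTerm F τ C (x n) s) (g s), hB₁ n s, hgB s]
  have hmeas : ∀ n, StronglyMeasurable fun s => ‖shiftedTerm F τ C (x n) s - g s‖ := fun n =>
    ((hgc n).stronglyMeasurable.sub hgm).norm
  have hDint : ∀ n, IntervalIntegrable (fun s => ‖shiftedTerm F τ C (x n) s - g s‖)
      volume 0 ω := fun n =>
    (intervalIntegrable_const (c := 2 * B₁)).mono_fun (hmeas n).aestronglyMeasurable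
      (Eventually.of_forall fun s => by
        simp only [norm_norm]
        exact (hbd n s).trans (le_abs_self _))
  have hD0 : Tendsto D atTop (𝓝 0) := by
    have h := intervalIntegral.tendsto_integral_filter_of_dominated_convergence
      (μ := volume) (a := 0) (b := ω) (l := atTop)
      (F := fun n s => ‖shiftedTerm F τ C (x n) s - g s‖) (f := fun _ => (0 : ℝ))
      (fun _ => 2 * B₁) (Eventually.of_forall fun n => (hmeas n).aestronglyMeasurable)
      (Eventually.of_forall fun n => Eventually.of_forall fun s _ => by
        simpa only [norm_norm] using hbd n s)
      intervalIntegrable_const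
      (Eventually.of_forall fun s _ => by
        have := ((hgt s).sub_const (g s)).norm
        simpa using this)
    simpa using h
  set K : ℝ := resolventConst (expShift C T) ω with hKdef
  have hK0 : 0 ≤ K := norm_nonneg _
  -- Two iterates are compared and `m → ∞`, because the estimate for `Q` cannot be applied to `u`
  -- before `u` is known to be continuous.
  have hle : ∀ n t, ‖x (n + 1) t - u t‖ ≤ K * (M * D n) := by
    intro n t
    have h1 : Tendsto (fun m => ‖x (n + 1) t - x (m + 1) t‖) atTop (𝓝 ‖x (n + 1) t - u t‖) :=
      (((hu t).comp (tendsto_add_atTop_nat 1)).const_sub _).norm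
    have h2 : Tendsto (fun m => K * (M * (D n + D m))) atTop (𝓝 (K * (M * (D n + 0)))) :=
      ((hD0.const_add _).const_mul M).const_mul K
    rw [add_zero] at h2
    refine le_of_tendsto_of_tendsto' h1 h2 fun m => ?_
    rw [hxs, hxs]
    refine (norm_iterOp_sub_le hSc hM hω.le (hgc n) (hgc m) (hgp n) (hgp m) t).trans ?_
    refine mul_le_mul_of_nonneg_left (mul_le_mul_of_nonneg_left ?_ hM0) hK0
    rw [hD, ← intervalIntegral.integral_add (hDint n) (hDint m)]
    refine intervalIntegral.integral_mono_on hω.le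
      (((hgc n).sub (hgc m)).norm.intervalIntegrable _ _) ((hDint n).add (hDint m)) fun s _ => ?_
    rw [norm_sub_rev (shiftedTerm F τ C (x m) s) (g s)]
    exact norm_sub_le_norm_sub_add_norm_sub _ _ _
  have hKD : Tendsto (fun n => K * (M * D n)) atTop (𝓝 0) := by
    simpa using (hD0.const_mul M).const_mul K
  have hunif : TendstoUniformly x u atTop := by
    rw [Metric.tendstoUniformly_iff]
    intro ε hε
    obtain ⟨n₀, hn₀⟩ := eventually_atTop.1 (hKD.eventually_lt_const hε)
    filter_upwards [eventually_ge_atTop (n₀ + 1)] with n hn t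
    obtain ⟨m, rfl⟩ : ∃ m, n = m + 1 := ⟨n - 1, by omega⟩
    rw [dist_comm, dist_eq_norm]
    exact (hle m t).trans_lt (hn₀ m (by omega))
  have huc : Continuous u := hunif.continuous (Frequently.of_forall fun n => (hx n).1)
  have hup : Function.Periodic u ω := fun t => tendsto_nhds_unique (hu (t + ω)) (by
    simpa only [(hx _).2.1 t] using hu t)
  have huI : u ∈ periodicIcc ω v₀ w₀ := ⟨huc, hup,
    fun t => ge_of_tendsto' (hu t) fun n => (hx n).2.2.1 t,
    fun t => le_of_tendsto' (hu t) fun n => (hx n).2.2.2 t⟩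
  refine ⟨u, huI, funext fun t => ?_, hunif⟩
  -- The shifted sequence `x (n + 1) t` also tends to `Q u t`, by the same bound `K * (M * D n)`.
  refine tendsto_nhds_unique ?_ ((hu t).comp (tendsto_add_atTop_nat 1))
  rw [tendsto_iff_norm_sub_tendsto_zero]
  refine squeeze_zero (fun _ => norm_nonneg _) (fun n => ?_) hKD
  simp only [Function.comp_apply, hxs]
  exact norm_iterOp_sub_le hSc hM hω.le (hgc n) (continuous_shiftedTerm hF τ C huc) (hgp n)
    (periodic_shiftedTerm hFp τ C hup) t

end MonotoneIteration

end DelayEvolution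

/-! ### Existence and extremality of the periodic mild solutions. -/

theorem theorem3p2 {E : Type*} [NormedAddCommGroup E] [NormedSpace ℝ E] [CompleteSpace E]
    [PartialOrder E] [IsOrderedAddMonoid E] [IsOrderedModule ℝ E] [OrderClosedTopology E]
    (hK : HasNormalCone E)
    (A : E →ₗ.[ℝ] E) (hA : A.IsClosed)
    (T : ℝ → E →L[ℝ] E) (hT : IsC0Semigroup T) (hAT : IsGenerator T (-A))
    (hTpos : IsPositiveSemigroup T) (hTeq : IsEquicontinuousSemigroup T)
    (ω τ : ℝ) (hω : 0 < ω) (hτ : 0 ≤ τ)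
    (F : ℝ → E → E → E) (hF : Continuous fun p : ℝ × E × E => F p.1 p.2.1 p.2.2)
    (hFper : ∀ x y : E, Function.Periodic (fun t => F t x y) ω)
    (v₀ w₀ : ℝ → E) (hv₀ : IsLowerSolution A F ω τ v₀) (hw₀ : IsUpperSolution A F ω τ w₀)
    (hvw : v₀ ≤ w₀)
    -- condition (H1)
    (C : ℝ) (hC : 0 ≤ C)
    (H1 : ∀ (t : ℝ) (x₁ x₂ y₁ y₂ : E), v₀ t ≤ x₁ → x₁ ≤ x₂ → x₂ ≤ w₀ t →
      v₀ (t - τ) ≤ y₁ → y₁ ≤ y₂ → y₂ ≤ w₀ (t - τ) →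
      -(C • (x₂ - x₁)) ≤ F t x₂ y₂ - F t x₁ y₁)
    -- the constants `C_S` and `M_S` of the semigroup `S(t) = e^{-Ct} T(t)` are well defined
    (hinv : IsUnit (1 - expShift C T ω))
    (hbdd : BddAbove ((fun t => ‖expShift C T t‖) '' Set.Ici 0))
    -- condition (H2)
    (c : ℝ) (hc : 0 ≤ c)
    (hc_lt : c * (4 * ω * resolventConst (expShift C T) ω * semigroupSup (expShift C T)) < 1)
    (H2 : ∀ (t : ℝ) (u : ℕ → ℝ → E), (∀ n, u n ∈ periodicIcc ω v₀ w₀) →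
      (Monotone u ∨ Antitone u) →
      kuratowski (Set.range fun n => F t (u n t) (u n (t - τ)) + C • u n t) ≤
        ENNReal.ofReal c * (kuratowski (Set.range fun n => u n t) +
          kuratowski (Set.range fun n => u n (t - τ)))) :
    ∃ u_min u_max : ℝ → E,
      -- minimal and maximal `ω`-periodic mild solutions between `v₀` and `w₀`
      IsLeast {u | IsPeriodicMildSolution T F ω τ u ∧ v₀ ≤ u ∧ u ≤ w₀} u_min ∧
      IsGreatest {u | IsPeriodicMildSolution T F ω τ u ∧ v₀ ≤ u ∧ u ≤ w₀} u_max ∧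
      -- obtained by monotone iteration starting from `v₀` and `w₀`
      (∀ n, (iterOp T F ω τ C)^[n] v₀ ∈ periodicIcc ω v₀ w₀) ∧
      (∀ n, (iterOp T F ω τ C)^[n] w₀ ∈ periodicIcc ω v₀ w₀) ∧
      Monotone (fun n => (iterOp T F ω τ C)^[n] v₀) ∧
      Antitone (fun n => (iterOp T F ω τ C)^[n] w₀) ∧
      TendstoUniformly (fun n => (iterOp T F ω τ C)^[n] v₀) u_min atTop ∧
      TendstoUniformly (fun n => (iterOp T F ω τ C)^[n] w₀) u_max atTop := by
  set S := expShift C T with hSdef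
  set Q := iterOp T F ω τ C with hQ
  have hM : ∀ t, 0 ≤ t → ‖S t‖ ≤ semigroupSup S := fun t ht => norm_le_semigroupSup hbdd ht
  have hS : IsC0Semigroup S := hT.expShift C
  have hSpos : IsPositiveSemigroup S := hTpos.expShift C
  have hSc := hS.continuous_uncurry_abs hM
  -- Only `S` is assumed bounded on `[0, ∞)`, so joint continuity of `T` is obtained by shifting `S`
  -- back.
  have hTc : Continuous fun p : ℝ × E => T |p.1| p.2 := by
    have := continuous_uncurry_abs_expShift hSc (-C)
    rwa [hSdef, expShift_neg_expShift] at this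
  have hv₀c := hv₀.contDiff.continuous
  have hw₀c := hw₀.contDiff.continuous
  -- regular functions are reproduced by the periodic resolvent formula
  have hrep : ∀ {v : ℝ → E} (hv : IsRegularPeriodic A ω v), ∃ g : ℝ → E, Continuous g ∧
      (g = fun t => (deriv v t + A ⟨v t, hv.mem_domain t⟩) + C • v t) ∧
      v = fun t => Ring.inverse (1 - S ω) (∫ s in (t - ω)..t, S (t - s) (g s)) := by
    intro v hv
    have hfc : Continuous fun t => deriv v t + A ⟨v t, hv.mem_domain t⟩ :=
      (hv.contDiff.continuous_deriv le_rfl).add hv.continuous_apply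
    have hgc := hfc.add (hv.contDiff.continuous.const_smul C)
    refine ⟨_, hgc, rfl, ?_⟩
    refine (isMild_iff_eq_inverse_integral hS hSc hω.le hinv hgc ?_ hv.periodic).1
      ((isMild_of_isRegularPeriodic hT hTc hAT hv).expShift hT hTc hfc C)
    intro t
    have hderiv : deriv v (t + ω) = deriv v t := by
      rw [← deriv_comp_add_const]
      exact congrArg (deriv · t) (funext hv.periodic)
    have hA' : A ⟨v (t + ω), hv.mem_domain (t + ω)⟩ = A ⟨v t, hv.mem_domain t⟩ := by
      simp only [hv.periodic t]
    change deriv v (t + ω) + A ⟨v (t + ω), _⟩ + C • v (t + ω) =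
      deriv v t + A ⟨v t, _⟩ + C • v t
    rw [hderiv, hA', hv.periodic t]
  have hres : ∀ {f g : ℝ → E}, Continuous f → Continuous g → f ≤ g → ∀ t,
      Ring.inverse (1 - S ω) (∫ s in (t - ω)..t, S (t - s) (f s)) ≤
      Ring.inverse (1 - S ω) (∫ s in (t - ω)..t, S (t - s) (g s)) := fun hf hg hfg t =>
    inverse_one_sub_map_mono hS hSpos hM hω.le hinv
      (integral_semigroup_mono hSpos hSc hf hg hfg (by linarith))
  -- Both sides are resolvent integrals: the forcing of `v₀` is `v₀' + A v₀ + C v₀`, which lies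
  -- below that of `Q v₀` by the lower-solution inequality.
  have hvQ : v₀ ≤ Q v₀ := by
    obtain ⟨g, hg, hgdef, hrepr⟩ := hrep hv₀.toIsRegularPeriodic
    intro t
    rw [congrFun hrepr t]
    refine hres hg (continuous_shiftedTerm hF τ C hv₀c) (fun s => ?_) t
    rw [hgdef]
    exact add_le_add_left (hv₀.le s) _
  have hQw : Q w₀ ≤ w₀ := by
    obtain ⟨g, hg, hgdef, hrepr⟩ := hrep hw₀.toIsRegularPeriodic
    intro t
    rw [congrFun hrepr t]
    refine hres (continuous_shiftedTerm hF τ C hw₀c) hg (fun s => ?_) t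
    rw [hgdef]
    exact add_le_add_left (hw₀.ge s) _
  have hQm : ∀ {u v : ℝ → E}, u ∈ periodicIcc ω v₀ w₀ → v ∈ periodicIcc ω v₀ w₀ → u ≤ v →
      Q u ≤ Q v := fun hu hv huv =>
    iterOp_mono hS hSpos hM hω.le hinv (continuous_shiftedTerm hF τ C hu.1)
      (continuous_shiftedTerm hF τ C hv.1) (shiftedTerm_mono H1 hu.2.2.1 huv hv.2.2.2)
  have hv₀I : v₀ ∈ periodicIcc ω v₀ w₀ := ⟨hv₀c, hv₀.periodic, le_rfl, hvw⟩
  have hw₀I : w₀ ∈ periodicIcc ω v₀ w₀ := ⟨hw₀c, hw₀.periodic, hvw, le_rfl⟩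
  have hQI : ∀ u ∈ periodicIcc ω v₀ w₀, Q u ∈ periodicIcc ω v₀ w₀ := fun u hu =>
    ⟨continuous_iterOp hSc hω.le (continuous_shiftedTerm hF τ C hu.1),
      periodic_iterOp T hω.le (periodic_shiftedTerm hFper τ C hu.2.1),
      hvQ.trans (hQm hv₀I hu hu.2.2.1), (hQm hu hw₀I hu.2.2.2).trans hQw⟩
  have hiter : ∀ {z : ℝ → E}, z ∈ periodicIcc ω v₀ w₀ → ∀ n, Q^[n] z ∈ periodicIcc ω v₀ w₀ := by
    intro z hz n
    induction n with
    | zero => exact hz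
    | succ n ih =>
      rw [Function.iterate_succ_apply']
      exact hQI _ ih
  have hIv := hiter hv₀I
  have hIw := hiter hw₀I
  have hiter_mono : ∀ {y z : ℝ → E}, y ∈ periodicIcc ω v₀ w₀ → z ∈ periodicIcc ω v₀ w₀ →
      y ≤ z → ∀ n, Q^[n] y ≤ Q^[n] z := by
    intro y z hy hz hyz n
    induction n with
    | zero => exact hyz
    | succ n ih =>
      rw [Function.iterate_succ_apply', Function.iterate_succ_apply']
      exact hQm (hiter hy n) (hiter hz n) ih
  have hmono : Monotone fun n => Q^[n] v₀ := monotone_nat_of_le_succ fun n => by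
    rw [Function.iterate_succ_apply]
    exact hiter_mono hv₀I (hQI _ hv₀I) hvQ n
  have hanti : Antitone fun n => Q^[n] w₀ := antitone_nat_of_succ_le fun n => by
    rw [Function.iterate_succ_apply]
    exact hiter_mono (hQI _ hw₀I) hw₀I hQw n
  obtain ⟨u, huI, huQ, hut⟩ := exists_tendstoUniformly_iterOp hK hSc hbdd hω hF hFper hv₀c
    hv₀.periodic hw₀c hw₀.periodic H1 hc hc_lt H2 hIv (Or.inl hmono)
    fun n => Function.iterate_succ_apply' Q n v₀
  obtain ⟨w, hwI, hwQ, hwt⟩ := exists_tendstoUniformly_iterOp hK hSc hbdd hω hF hFper hv₀c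
    hv₀.periodic hw₀c hw₀.periodic H1 hc hc_lt H2 hIw (Or.inr hanti)
    fun n => Function.iterate_succ_apply' Q n w₀
  have hsol : ∀ {z : ℝ → E}, z ∈ periodicIcc ω v₀ w₀ →
      (IsPeriodicMildSolution T F ω τ z ↔ Q z = z) := fun hz =>
    isPeriodicMildSolution_iff hT hTc hω.le hinv hF hFper hz.1 hz.2.1
  refine ⟨u, w, ⟨⟨(hsol huI).2 huQ, huI.2.2⟩, ?_⟩, ⟨⟨(hsol hwI).2 hwQ, hwI.2.2⟩, ?_⟩,
    hIv, hIw, hmono, hanti, hut, hwt⟩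
  -- A solution `z` is fixed by every `Q^[n]`, so `v₀ ≤ z` propagates to all iterates and to their
  -- limit.
  · rintro z ⟨hz, hvz, hzw⟩ t
    have hzI : z ∈ periodicIcc ω v₀ w₀ := ⟨hz.continuous, hz.periodic, hvz, hzw⟩
    refine le_of_tendsto' (hut.tendsto_at t) fun n => ?_
    have := hiter_mono hv₀I hzI hvz n t
    rwa [Function.iterate_fixed ((hsol hzI).1 hz)] at this
  · rintro z ⟨hz, hvz, hzw⟩ t
    have hzI : z ∈ periodicIcc ω v₀ w₀ := ⟨hz.continuous, hz.periodic, hvz, hzw⟩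
    refine ge_of_tendsto' (hwt.tendsto_at t) fun n => ?_
    have := hiter_mono hzI hw₀I hzw n t
    rwa [Function.iterate_fixed ((hsol hzI).1 hz)] at this
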